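/- **Setting.** A *state space* is a compact convex set $\Omega$ in a finite-dimensional real Euclidean space $V$ with $\mathrm{span}(\Omega)=V$ and $0\notin\mathrm{aff}(\Omega)$. An *effect* is a linear functional $e$ on $V$ with $e(\Omega)\subseteq[0,1]$; the *unit effect* $u$ is the one with $u(\omega)=1$ for all $\omega\in\Omega$; an *observable* is a finite family of effects $(e_x)_{x\in X}$ with $\sum_x e_x=u$. States $(\omega_x)_{x\in X}$ are *perfectly distinguishable* if some observable satisfies $e_x(\omega_y)=\delta_{xy}$, and a family of states is *pairwise distinguishable* if any two of its members are perfectly distinguishable. The *fidelity* is $F(\omega,\sigma)=\inf\sum_x e_x(\omega)^{1/2}e_x(\sigma)^{1/2}$, the infimum being over all observables. A *reversible dynamics* of $\Omega$ is a linear map $V\to V$ that restricts to a bijection $\Omega\to\Omega$; the set of these is $GL(\Omega)$. Let $\Omega_{sys}\subset V$ and $\Omega_{app}\subset W$ be state spaces (system and apparatus), with unit effects $u_{sys}$ and $u_{app}$. Let $\Omega_{tot}\subset V\otimes W$ be any state space with $\Omega_{sys}\otimes_{min}\Omega_{app}\subseteq\Omega_{tot}\subseteq\Omega_{sys}\otimes_{max}\Omega_{app}$,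 where $\Omega_{sys}\otimes_{min}\Omega_{app}$ is the convex hull of all $\omega\otimes\xi$ with $\omega\in\Omega_{sys}$, $\xi\in\Omega_{app}$, and $\Omega_{sys}\otimes_{max}\Omega_{app}$ is the set of $\mu\in V\otimes W$ with $(u_{sys}\otimes u_{app})(\mu)=1$ and $(e\otimes f)(\mu)\ge 0$ for all effects $e$ of $\Omega_{sys}$ and $f$ of $\Omega_{app}$. Fix $\Lambda\in GL(\Omega_{tot})$. A state $\xi\in\Omega_{app}$ *implements* $\alpha\in GL(\Omega_{sys})$ through $\Lambda$ if $$(e\otimes u_{app})\bigl(\Lambda(\omega\otimes\xi)\bigr)=e(\alpha\omega)$$ for all $\omega\in\Omega_{sys}$ and all effects $e$ of $\Omega_{sys}$. **Theorem.** 1. If $\xi,\eta\in\Omega_{app}$ implement $\alpha_\xi,\alpha_\eta\in GL(\Omega_{sys})$ through $\Lambda$ and $\alpha_\xi\ne\alpha_\eta$, then $\xi$ and $\eta$ are perfectly distinguishable, and $F(\xi,\eta)=0$. 2. Consequently, any family $(\xi_i)_{i\in I}$ of states of the apparatus implementing pairwise distinct reversible dynamics $\alpha_i\in GL(\Omega_{sys})$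 through $\Lambda$ is pairwise distinguishable. 3. Only finitely many $\alpha\in GL(\Omega_{sys})$ are implemented through $\Lambda$ by some state of $\Omega_{app}$. -/

import Mathlib

open scoped TensorProduct

noncomputable section

namespace GPT

/-- A state space: a compact convex set in a Euclidean space `V` that spans `V` linearly and whose
affine hull does not contain the origin. -/
structure StateSpace (V : Type*) [NormedAddCommGroup V] [InnerProductSpace ℝ V] where
  /-- the set of states -/
  states : Set V
  isCompact : IsCompact states
  convex : Convex ℝ states
  span_eq_top : Submodule.span ℝ states = ⊤
  zero_notMem_affineSpan : (0 : V) ∉ affineSpan ℝ states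

section Single

variable {V : Type*} [NormedAddCommGroup V] [InnerProductSpace ℝ V]

/-- The effects: linear functionals on `V` taking values in `[0, 1]` on states. All of them are
admitted (no-restriction hypothesis). -/
def StateSpace.effects (Ω : StateSpace V) : Set (Module.Dual ℝ V) :=
  {e | ∀ ω ∈ Ω.states, e ω ∈ Set.Icc (0 : ℝ) 1}

/-- The linear functional that equals `1` on all states exists and is unique. -/
theorem StateSpace.existsUnique_unit (Ω : StateSpace V) :
    ∃! u : Module.Dual ℝ V, ∀ ω ∈ Ω.states, u ω = 1 := by
  refine existsUnique_of_exists_of_unique ?_ ?_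
  · rcases Ω.states.eq_empty_or_nonempty with h | ⟨p, hp⟩
    · exact ⟨0, by simp [h]⟩
    · have hpA : p ∈ affineSpan ℝ Ω.states := subset_affineSpan ℝ _ hp
      have hpD : p ∉ (affineSpan ℝ Ω.states).direction := by
        intro hpD
        have h0 := AffineSubspace.vadd_mem_of_mem_direction (Submodule.neg_mem _ hpD) hpA
        exact Ω.zero_notMem_affineSpan (by simpa using h0)
      obtain ⟨f, hf, hD⟩ := Submodule.exists_dual_map_eq_bot_of_notMem hpD inferInstance
      have hker : ∀ v ∈ (affineSpan ℝ Ω.states).direction, f v = 0 := fun v hv => by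
        have : f v ∈ Submodule.map f (affineSpan ℝ Ω.states).direction :=
          Submodule.mem_map_of_mem hv
        rw [hD] at this
        simpa using this
      refine ⟨(f p)⁻¹ • f, fun ω hω => ?_⟩
      have h1 : f (ω -ᵥ p) = 0 :=
        hker _ (AffineSubspace.vsub_mem_direction (subset_affineSpan ℝ _ hω) hpA)
      have h2 : f ω = f p := by
        rw [vsub_eq_sub, map_sub] at h1
        linarith
      simp [h2, hf]
  · intro u v hu hv
    refine LinearMap.ext_on Ω.span_eq_top fun ω hω => ?_
    rw [hu ω hω, hv ω hω]

/-- The unit effect. -/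
def StateSpace.unit (Ω : StateSpace V) : Module.Dual ℝ V :=
  Ω.existsUnique_unit.choose

theorem StateSpace.unit_apply (Ω : StateSpace V) {ω : V} (hω : ω ∈ Ω.states) : Ω.unit ω = 1 :=
  Ω.existsUnique_unit.choose_spec.1 ω hω

/-- An observable with finite outcome set `X`: a family of effects summing to the unit effect. -/
def StateSpace.IsObservable (Ω : StateSpace V) {X : Type*} [Fintype X]
    (E : X → Module.Dual ℝ V) : Prop :=
  (∀ x, E x ∈ Ω.effects) ∧ ∑ x, E x = Ω.unit

/-- A finite family of states is perfectly distinguishable if some observable with the same index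
set satisfies `e_x (ω_y) = δ_{xy}`. -/
def StateSpace.PerfectlyDistinguishable (Ω : StateSpace V) {X : Type*} [Fintype X] [DecidableEq X]
    (ω : X → V) : Prop :=
  (∀ x, ω x ∈ Ω.states) ∧
    ∃ E : X → Module.Dual ℝ V, Ω.IsObservable E ∧ ∀ x y, E x (ω y) = if x = y then 1 else 0

/-- An arbitrary family of states is pairwise distinguishable if any two of its members are
perfectly distinguishable. -/
def StateSpace.PairwiseDistinguishable (Ω : StateSpace V) {ι : Type*} (ω : ι → V) : Prop :=
  ∀ i j, i ≠ j → Ω.PerfectlyDistinguishable ![ω i, ω j]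

/-- The fidelity `F(ω, σ) = inf ∑_x √(e_x ω) √(e_x σ)`, the infimum being over all observables.
As outcome sets are finite, they are taken to be `Fin n`, with `n` arbitrary. -/
def StateSpace.fidelity (Ω : StateSpace V) (ω σ : V) : ℝ :=
  sInf {r | ∃ (n : ℕ) (E : Fin n → Module.Dual ℝ V), Ω.IsObservable E ∧
    r = ∑ x, Real.sqrt (E x ω) * Real.sqrt (E x σ)}

/-- Channels, as linear maps of the ambient spaces. -/
def channels {V W : Type*} [NormedAddCommGroup V] [InnerProductSpace ℝ V]
    [NormedAddCommGroup W] [InnerProductSpace ℝ W] (Ω : StateSpace V) (Ω' : StateSpace W) :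
    Set (V →ₗ[ℝ] W) :=
  {Λ | Set.MapsTo Λ Ω.states Ω'.states}

/-- Reversible dynamics: channels from a system to itself that are bijective on states. -/
def StateSpace.GL (Ω : StateSpace V) : Set (V →ₗ[ℝ] V) :=
  {Λ | Λ ∈ channels Ω Ω ∧ Set.BijOn Λ Ω.states Ω.states}

end Single

section Bipartite

variable {V W : Type*} [NormedAddCommGroup V] [InnerProductSpace ℝ V]
  [NormedAddCommGroup W] [InnerProductSpace ℝ W]

/-- The functional `e ⊗ f` on `V ⊗ W`, with `(e ⊗ f) (v ⊗ w) = e v * f w`. -/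
def prodFunctional (e : Module.Dual ℝ V) (f : Module.Dual ℝ W) : Module.Dual ℝ (V ⊗[ℝ] W) :=
  TensorProduct.dualDistrib ℝ V W (e ⊗ₜ[ℝ] f)

/-- The minimal tensor product: convex combinations of product states. -/
def minTensor (Ω₁ : StateSpace V) (Ω₂ : StateSpace W) : Set (V ⊗[ℝ] W) :=
  convexHull ℝ {μ | ∃ ω ∈ Ω₁.states, ∃ ξ ∈ Ω₂.states, μ = ω ⊗ₜ[ℝ] ξ}

/-- The maximal tensor product: normalized elements on which all product effects are
nonnegative. -/
def maxTensor (Ω₁ : StateSpace V) (Ω₂ : StateSpace W) : Set (V ⊗[ℝ] W) :=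
  {μ | prodFunctional Ω₁.unit Ω₂.unit μ = 1 ∧
    ∀ e ∈ Ω₁.effects, ∀ f ∈ Ω₂.effects, 0 ≤ prodFunctional e f μ}

/-- `Ω₁₂` is a bipartite composite of `Ω₁` and `Ω₂`: a state space in `V ⊗ W` lying between the
minimal and the maximal tensor product. -/
def IsComposite (Ω₁ : StateSpace V) (Ω₂ : StateSpace W) (Ω₁₂ : StateSpace (V ⊗[ℝ] W)) : Prop :=
  minTensor Ω₁ Ω₂ ⊆ Ω₁₂.states ∧ Ω₁₂.states ⊆ maxTensor Ω₁ Ω₂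

/-- The apparatus state `ξ` (the program) implements the dynamics `α` of the system through `Λ`:
`⟨e ⊗ u_app, Λ (ω ⊗ ξ)⟩ = ⟨e, α ω⟩` for all states `ω` and effects `e` of the system. -/
def Implements (Ωsys : StateSpace V) (Ωapp : StateSpace W)
    (Λ : V ⊗[ℝ] W →ₗ[ℝ] V ⊗[ℝ] W) (ξ : W) (α : V →ₗ[ℝ] V) : Prop :=
  ∀ ω ∈ Ωsys.states, ∀ e ∈ Ωsys.effects,
    prodFunctional e Ωapp.unit (Λ (ω ⊗ₜ[ℝ] ξ)) = e (α ω)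

end Bipartite

end GPT

end

/-!
The proof compares fidelities along the dynamics `Λ`. Fidelity does not decrease under channels
(`StateSpace.fidelity_le_fidelity_map`), and on products it is submultiplicative
(`IsComposite.fidelity_tmul_le`).

Let `a` be a pure state of the system. If `ξ` implements `α`, then `Λ (a ⊗ ξ)` has the pure
marginal `α a`, hence is a product `α a ⊗ ξ' a` (`eq_tmul_of_marginal_mem_extremePoints`); likewise
`Λ (a ⊗ η) = β a ⊗ η' a` if `η` implements `β`. When `α ≠ β`, some pure `a` has `α a ≠ β a`, because
pure states span. Put `b = β⁻¹ (α a)`, a pure state different from `a`, and `g = F (a, b) < 1`.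
Comparing the inputs `a ⊗ ξ` and `a ⊗ η` before and after `Λ` gives
`F (ξ, η) ≤ g * F (ξ' a, η' a)`. Comparing `a ⊗ ξ` and `b ⊗ η`, which `Λ` maps to `α a ⊗ ξ' a` and
`α a ⊗ η' b`, gives `F (ξ' a, η' b) ≤ g * F (ξ, η)`, by reversibility of `Λ`.

If the residual states `η' a` and `η' b` agree, then `F (ξ, η) ≤ g ^ 2 * F (ξ, η)` and so
`F (ξ, η) = 0`. If they differ, say under a functional `f`, then every pure state is an eigenvector
of the linear map `β⁻¹ ∘ (id ⊗ f) ∘ Λ ∘ (· ⊗ η)`, with different eigenvalues at `a` and `b`; a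
polynomial in this map yields an effect distinguishing `a` from `b`
(`StateSpace.fidelity_eq_zero_of_eigenvalue_ne`), so `g = 0` and again `F (ξ, η) = 0`.

Fidelity zero implies perfect distinguishability by compactness of the set of effects
(`StateSpace.perfectlyDistinguishable_of_fidelity_eq_zero`). Effects are also uniformly Lipschitz,
so pairwise distinguishable states are uniformly separated in a compact set and hence finite in
number (`StateSpace.PairwiseDistinguishable.finite`).
-/

open scoped TensorProduct

noncomputable section

namespace GPT

section Single

variable {V : Type*} [NormedAddCommGroup V] [InnerProductSpace ℝ V]

namespace StateSpace

/-! ### Effects and observables -/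

theorem unit_mem_effects (Ω : StateSpace V) : Ω.unit ∈ Ω.effects := fun ω hω => by
  simp [Ω.unit_apply hω]

theorem unit_sub_mem_effects (Ω : StateSpace V) {e : Module.Dual ℝ V} (he : e ∈ Ω.effects) :
    Ω.unit - e ∈ Ω.effects := fun ω hω => by
  have h := he ω hω
  simp only [LinearMap.sub_apply, Ω.unit_apply hω, Set.mem_Icc] at h ⊢
  exact ⟨by linarith [h.2], by linarith [h.1]⟩

theorem eq_unit_of_forall (Ω : StateSpace V) {e : Module.Dual ℝ V}
    (he : ∀ ω ∈ Ω.states, e ω = 1) : e = Ω.unit :=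
  LinearMap.ext_on Ω.span_eq_top fun ω hω => by rw [he ω hω, Ω.unit_apply hω]

/-- The effects span the dual space: every functional is bounded on the compact set of states, so
an affine rescaling turns it into an effect. -/
theorem exists_eq_smul_effect_add_smul_unit [FiniteDimensional ℝ V] (Ω : StateSpace V)
    (g : Module.Dual ℝ V) :
    ∃ e ∈ Ω.effects, ∃ c d : ℝ, g = c • e + d • Ω.unit := by
  obtain ⟨C, hC⟩ := Ω.isCompact.exists_bound_of_continuousOn
    (LinearMap.continuous_of_finiteDimensional g).continuousOn
  set K : ℝ := |C| + 1 with hK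
  have hK0 : 0 < K := by positivity
  refine ⟨(2 * K)⁻¹ • (g + K • Ω.unit), fun ω hω => ?_, 2 * K, -K, ?_⟩
  · have h1 := (abs_le.1 ((hC ω hω).trans (le_abs_self C)))
    simp only [LinearMap.smul_apply, LinearMap.add_apply, Ω.unit_apply hω, smul_eq_mul, mul_one,
      Set.mem_Icc]
    constructor
    · exact mul_nonneg (by positivity) (by linarith [h1.1])
    · rw [inv_mul_le_iff₀ (by positivity)]
      linarith [h1.2]
  · rw [smul_smul, mul_inv_cancel₀ (by positivity)]
    module

theorem ext_effects [FiniteDimensional ℝ V] (Ω : StateSpace V) {v w : V}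
    (h : ∀ e ∈ Ω.effects, e v = e w) : v = w := by
  rw [← sub_eq_zero, ← Module.forall_dual_apply_eq_zero_iff ℝ]
  intro g
  obtain ⟨e, he, c, d, rfl⟩ := Ω.exists_eq_smul_effect_add_smul_unit g
  simp [h e he, h _ Ω.unit_mem_effects]

theorem isObservable_pair (Ω : StateSpace V) {e : Module.Dual ℝ V} (he : e ∈ Ω.effects) :
    Ω.IsObservable ![e, Ω.unit - e] := by
  refine ⟨fun x => ?_, by simp⟩
  fin_cases x
  · exact he
  · exact Ω.unit_sub_mem_effects he

theorem IsObservable.sum_apply {Ω : StateSpace V} {X : Type*} [Fintype X]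
    {E : X → Module.Dual ℝ V} (hE : Ω.IsObservable E) {ω : V} (hω : ω ∈ Ω.states) :
    ∑ x, E x ω = 1 := by
  rw [← LinearMap.sum_apply, hE.2, Ω.unit_apply hω]

/-- Observables are pulled back along linear maps that send states to states. -/
theorem IsObservable.comp {V' : Type*} [NormedAddCommGroup V'] [InnerProductSpace ℝ V']
    {Ω : StateSpace V} {Ω' : StateSpace V'} {X : Type*} [Fintype X] {E : X → Module.Dual ℝ V'}
    (hE : Ω'.IsObservable E) {Φ : V →ₗ[ℝ] V'} (hΦ : Φ ∈ channels Ω Ω') :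
    Ω.IsObservable fun x => E x ∘ₗ Φ := by
  refine ⟨fun x ω hω => hE.1 x _ (hΦ hω), Ω.eq_unit_of_forall fun ω hω => ?_⟩
  simpa using hE.sum_apply (hΦ hω)

/-! ### Fidelity -/

theorem fidelity_nonneg (Ω : StateSpace V) (ω σ : V) : 0 ≤ Ω.fidelity ω σ := by
  refine Real.sInf_nonneg ?_
  rintro _ ⟨n, E, -, rfl⟩
  positivity

theorem fidelity_le (Ω : StateSpace V) {X : Type*} [Fintype X] {E : X → Module.Dual ℝ V}
    (hE : Ω.IsObservable E) (ω σ : V) :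
    Ω.fidelity ω σ ≤ ∑ x, Real.sqrt (E x ω) * Real.sqrt (E x σ) := by
  refine csInf_le ⟨0, ?_⟩ ⟨Fintype.card X, fun i => E ((Fintype.equivFin X).symm i),
    ⟨fun i => hE.1 _, ?_⟩, ?_⟩
  · rintro _ ⟨n, E, -, rfl⟩
    positivity
  · rw [Equiv.sum_comp (Fintype.equivFin X).symm E, hE.2]
  · exact (Equiv.sum_comp (Fintype.equivFin X).symm
      fun x => Real.sqrt (E x ω) * Real.sqrt (E x σ)).symm

theorem fidelity_set_nonempty (Ω : StateSpace V) (ω σ : V) :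
    {r | ∃ (n : ℕ) (E : Fin n → Module.Dual ℝ V), Ω.IsObservable E ∧
      r = ∑ x, Real.sqrt (E x ω) * Real.sqrt (E x σ)}.Nonempty :=
  ⟨_, 2, _, Ω.isObservable_pair Ω.unit_mem_effects, rfl⟩

theorem le_fidelity (Ω : StateSpace V) {ω σ : V} {c : ℝ}
    (h : ∀ (n : ℕ) (E : Fin n → Module.Dual ℝ V), Ω.IsObservable E →
      c ≤ ∑ x, Real.sqrt (E x ω) * Real.sqrt (E x σ)) : c ≤ Ω.fidelity ω σ := by
  refine le_csInf (Ω.fidelity_set_nonempty ω σ) ?_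
  rintro _ ⟨n, E, hE, rfl⟩
  exact h n E hE

theorem exists_observable_lt (Ω : StateSpace V) {ω σ : V} {c : ℝ} (h : Ω.fidelity ω σ < c) :
    ∃ (n : ℕ) (E : Fin n → Module.Dual ℝ V), Ω.IsObservable E ∧
      ∑ x, Real.sqrt (E x ω) * Real.sqrt (E x σ) < c := by
  obtain ⟨_, ⟨n, E, hE, rfl⟩, hlt⟩ := exists_lt_of_csInf_lt (Ω.fidelity_set_nonempty ω σ) h
  exact ⟨n, E, hE, hlt⟩

theorem fidelity_le_fidelity_map {V' : Type*} [NormedAddCommGroup V'] [InnerProductSpace ℝ V']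
    {Ω : StateSpace V} {Ω' : StateSpace V'} {Φ : V →ₗ[ℝ] V'} (hΦ : Φ ∈ channels Ω Ω') (ω σ : V) :
    Ω.fidelity ω σ ≤ Ω'.fidelity (Φ ω) (Φ σ) :=
  Ω'.le_fidelity fun _ _ hE => Ω.fidelity_le (hE.comp hΦ) ω σ

/-- Distinct states have fidelity less than one: an effect that separates them gives a two-outcome
observable for which the Cauchy–Schwarz inequality is strict. -/
theorem fidelity_lt_one [FiniteDimensional ℝ V] (Ω : StateSpace V) {ω σ : V}
    (hω : ω ∈ Ω.states) (hσ : σ ∈ Ω.states) (h : ω ≠ σ) : Ω.fidelity ω σ < 1 := by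
  obtain ⟨e, he, hne⟩ : ∃ e ∈ Ω.effects, e ω ≠ e σ := by
    by_contra! H
    exact h (Ω.ext_effects H)
  refine (Ω.fidelity_le (Ω.isObservable_pair he) ω σ).trans_lt ?_
  have hp := he ω hω
  have hq := he σ hσ
  simp only [Fin.sum_univ_two, Matrix.cons_val_zero, Matrix.cons_val_one, LinearMap.sub_apply,
    Ω.unit_apply hω, Ω.unit_apply hσ]
  have h1 := Real.sq_sqrt hp.1
  have h2 := Real.sq_sqrt hq.1
  have h3 := Real.sq_sqrt (sub_nonneg.2 hp.2)
  have h4 := Real.sq_sqrt (sub_nonneg.2 hq.2)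
  have h5 : Real.sqrt (e ω) - Real.sqrt (e σ) ≠ 0 := fun h0 =>
    hne ((Real.sqrt_inj hp.1 hq.1).1 (sub_eq_zero.1 h0))
  have h6 := pow_pos (abs_pos.2 h5) 2
  rw [sq_abs] at h6
  nlinarith [sq_nonneg (Real.sqrt (1 - e ω) - Real.sqrt (1 - e σ))]

theorem fidelity_eq_zero_of_effect (Ω : StateSpace V) {ω σ : V} (hω : ω ∈ Ω.states)
    {e : Module.Dual ℝ V} (he : e ∈ Ω.effects) (h1 : e ω = 1) (h0 : e σ = 0) :
    Ω.fidelity ω σ = 0 := by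
  refine le_antisymm ((Ω.fidelity_le (Ω.isObservable_pair he) ω σ).trans_eq ?_)
    (Ω.fidelity_nonneg ω σ)
  simp [Ω.unit_apply hω, h1, h0]

/-! ### Perfect distinguishability -/

theorem PerfectlyDistinguishable.exists_effect {Ω : StateSpace V} {ω σ : V}
    (h : Ω.PerfectlyDistinguishable ![ω, σ]) : ∃ e ∈ Ω.effects, e ω = 1 ∧ e σ = 0 := by
  obtain ⟨-, E, hE, h⟩ := h
  exact ⟨E 0, hE.1 0, by simpa using h 0 0, by simpa using h 0 1⟩

theorem perfectlyDistinguishable_of_effect (Ω : StateSpace V) {ω σ : V} (hω : ω ∈ Ω.states)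
    (hσ : σ ∈ Ω.states) {e : Module.Dual ℝ V} (he : e ∈ Ω.effects) (h1 : e ω = 1)
    (h0 : e σ = 0) : Ω.PerfectlyDistinguishable ![ω, σ] := by
  refine ⟨fun x => ?_, _, Ω.isObservable_pair he, fun x y => ?_⟩
  · fin_cases x <;> assumption
  · fin_cases x <;> fin_cases y <;> simp [h1, h0, Ω.unit_apply hω, Ω.unit_apply hσ]

/-- States of small fidelity are nearly distinguished by the effect that collects the outcomes
at least as likely on the first state as on the second. -/
theorem exists_effect_of_fidelity_lt (Ω : StateSpace V) {ω σ : V} (hω : ω ∈ Ω.states)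
    (hσ : σ ∈ Ω.states) {ε : ℝ} (h : Ω.fidelity ω σ < ε) :
    ∃ e ∈ Ω.effects, 1 - ε ≤ e ω ∧ e σ ≤ ε := by
  classical
  obtain ⟨n, E, hE, hlt⟩ := Ω.exists_observable_lt h
  have hpos : ∀ x, ∀ ρ ∈ Ω.states, 0 ≤ E x ρ := fun x ρ hρ => (hE.1 x ρ hρ).1
  -- the smaller of two numbers is at most their geometric mean
  have hmin : ∀ p q : ℝ, 0 ≤ p → p ≤ q → p ≤ Real.sqrt p * Real.sqrt q := fun p q hp hpq =>
    (Real.mul_self_sqrt hp).symm.trans_le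
      (mul_le_mul_of_nonneg_left (Real.sqrt_le_sqrt hpq) (Real.sqrt_nonneg p))
  set A : Finset (Fin n) := Finset.univ.filter fun x => E x σ ≤ E x ω with hA
  have hsplit : ∀ g : Fin n → ℝ, ∑ x, g x = ∑ x ∈ A, g x + ∑ x ∈ Aᶜ, g x := fun g =>
    (Finset.sum_add_sum_compl A g).symm
  have hsum : ∀ B : Finset (Fin n),
      ∑ x ∈ B, Real.sqrt (E x ω) * Real.sqrt (E x σ) ≤ ε := fun B =>
    (Finset.sum_le_univ_sum_of_nonneg fun x => by positivity).trans hlt.le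
  refine ⟨∑ x ∈ A, E x, fun ρ hρ => ?_, ?_, ?_⟩
  · rw [LinearMap.sum_apply, ← hE.sum_apply hρ]
    exact ⟨Finset.sum_nonneg fun x _ => hpos x ρ hρ,
      Finset.sum_le_univ_sum_of_nonneg fun x => hpos x ρ hρ⟩
  · have h1 : ∑ x ∈ Aᶜ, E x ω ≤ ε := by
      refine (Finset.sum_le_sum fun x hx => ?_).trans (hsum Aᶜ)
      have : E x ω < E x σ := by simpa [hA] using hx
      exact hmin _ _ (hpos x ω hω) this.le
    have h2 := hsplit fun x => E x ω
    rw [hE.sum_apply hω] at h2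
    rw [LinearMap.sum_apply]
    linarith
  · rw [LinearMap.sum_apply]
    refine (Finset.sum_le_sum fun x hx => ?_).trans (hsum A)
    rw [mul_comm]
    exact hmin _ _ (hpos x σ hσ) (by simpa [hA] using hx)

theorem exists_basis_of_states [FiniteDimensional ℝ V] (Ω : StateSpace V) :
    ∃ (n : ℕ) (b : Module.Basis (Fin n) ℝ V), ∀ i, b i ∈ Ω.states := by
  let b := Module.Basis.ofSpan Ω.span_eq_top.ge
  have := FiniteDimensional.fintypeBasisIndex b
  refine ⟨_, b.reindex (Fintype.equivFin _), fun i => ?_⟩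
  rw [Module.Basis.reindex_apply]
  exact Module.Basis.ofSpan_subset Ω.span_eq_top.ge (Set.mem_range_self _)

/-- The effects are compact for the topology of pointwise convergence, because an effect is
determined by its values in `[0, 1]` on a basis of states. -/
theorem exists_effect_tendsto [FiniteDimensional ℝ V] (Ω : StateSpace V)
    (e : ℕ → Module.Dual ℝ V) (he : ∀ n, e n ∈ Ω.effects) :
    ∃ e₀ ∈ Ω.effects, ∃ φ : ℕ → ℕ, StrictMono φ ∧
      ∀ v, Filter.Tendsto (fun n => e (φ n) v) Filter.atTop (nhds (e₀ v)) := by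
  obtain ⟨d, b, hb⟩ := Ω.exists_basis_of_states
  have hK : IsCompact (Set.univ.pi fun _ : Fin d => Set.Icc (0 : ℝ) 1) :=
    isCompact_univ_pi fun _ => isCompact_Icc
  obtain ⟨c, -, φ, hφ, hc⟩ := hK.tendsto_subseq (x := fun n i => e n (b i))
    fun n i _ => he n _ (hb i)
  have hlim : ∀ v, Filter.Tendsto (fun n => e (φ n) v) Filter.atTop
      (nhds (b.constr ℝ c v)) := fun v => by
    have h : ∀ f : Module.Dual ℝ V, f v = ∑ i, b.repr v i * f (b i) := fun f => by
      conv_lhs => rw [← b.sum_repr v]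
      simp only [map_sum, map_smul, smul_eq_mul]
    simp only [h, b.constr_basis]
    exact tendsto_finsetSum _ fun i _ => (tendsto_pi_nhds.1 hc i).const_mul _
  exact ⟨b.constr ℝ c, fun ω hω => isClosed_Icc.mem_of_tendsto (hlim ω)
    (Filter.Eventually.of_forall fun n => he _ ω hω), φ, hφ, hlim⟩

theorem perfectlyDistinguishable_of_fidelity_eq_zero [FiniteDimensional ℝ V] (Ω : StateSpace V)
    {ω σ : V} (hω : ω ∈ Ω.states) (hσ : σ ∈ Ω.states) (h : Ω.fidelity ω σ = 0) :
    Ω.PerfectlyDistinguishable ![ω, σ] := by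
  have hε : ∀ n : ℕ, ∃ e ∈ Ω.effects, 1 - 1 / ((n : ℝ) + 1) ≤ e ω ∧ e σ ≤ 1 / ((n : ℝ) + 1) :=
    fun n => Ω.exists_effect_of_fidelity_lt hω hσ (by rw [h]; positivity)
  choose e he h1 h0 using hε
  obtain ⟨e₀, he₀, φ, hφ, hlim⟩ := Ω.exists_effect_tendsto e he
  have ht : Filter.Tendsto (fun n : ℕ => 1 / ((φ n : ℝ) + 1)) Filter.atTop (nhds 0) :=
    tendsto_one_div_add_atTop_nhds_zero_nat.comp hφ.tendsto_atTop
  refine Ω.perfectlyDistinguishable_of_effect hω hσ he₀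
    (le_antisymm (he₀ ω hω).2 ?_) (le_antisymm ?_ (he₀ σ hσ).1)
  · have := le_of_tendsto_of_tendsto' (ht.const_sub 1) (hlim ω) fun n => h1 _
    simpa using this
  · exact le_of_tendsto_of_tendsto' (hlim σ) ht fun n => h0 _

theorem exists_effect_lipschitz [FiniteDimensional ℝ V] (Ω : StateSpace V) :
    ∃ C > 0, ∀ e ∈ Ω.effects, ∀ v, e v ≤ C * ‖v‖ := by
  obtain ⟨d, b, hb⟩ := Ω.exists_basis_of_states
  let f : Fin d → V →L[ℝ] ℝ := fun i => LinearMap.toContinuousLinearMap (b.coord i)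
  refine ⟨∑ i, ‖f i‖ + 1, by positivity, fun e he v => ?_⟩
  calc e v = ∑ i, b.repr v i * e (b i) := by
        conv_lhs => rw [← b.sum_repr v]
        simp only [map_sum, map_smul, smul_eq_mul]
    _ ≤ ∑ i, ‖f i‖ * ‖v‖ := by
        refine Finset.sum_le_sum fun i _ => ?_
        have h := he _ (hb i)
        calc b.repr v i * e (b i) ≤ |b.repr v i| * e (b i) :=
              mul_le_mul_of_nonneg_right (le_abs_self _) h.1
          _ ≤ |b.repr v i| := mul_le_of_le_one_right (abs_nonneg _) h.2
          _ ≤ ‖f i‖ * ‖v‖ := (f i).le_opNorm v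
    _ ≤ (∑ i, ‖f i‖ + 1) * ‖v‖ := by
        rw [← Finset.sum_mul, add_mul]
        linarith [norm_nonneg v]

/-- Pairwise distinguishable families are finite: effects are uniformly Lipschitz, so the members
are separated by a fixed distance inside a compact set. -/
theorem PairwiseDistinguishable.finite [FiniteDimensional ℝ V] {Ω : StateSpace V} {ι : Type*}
    {ω : ι → V} (hmem : ∀ i, ω i ∈ Ω.states) (h : Ω.PairwiseDistinguishable ω) : Finite ι := by
  obtain ⟨C, hC, hLip⟩ := Ω.exists_effect_lipschitz
  obtain ⟨t, -, ht, hcov⟩ := Ω.isCompact.finite_cover_balls (e := (2 * C)⁻¹) (by positivity)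
  have hball : ∀ i, ∃ x : t, dist (ω i) x < (2 * C)⁻¹ := fun i => by
    obtain ⟨x, hx, hd⟩ := Set.mem_iUnion₂.1 (hcov (hmem i))
    exact ⟨⟨x, hx⟩, hd⟩
  choose c hc using hball
  have := ht.to_subtype
  refine Finite.of_injective c fun i j hij => ?_
  by_contra hne
  obtain ⟨e, he, h1, h0⟩ := (h i j hne).exists_effect
  have h2 := hLip e he (ω i - ω j)
  rw [map_sub, h1, h0, sub_zero, ← dist_eq_norm] at h2
  have h3 : dist (ω i) (ω j) < (2 * C)⁻¹ + (2 * C)⁻¹ :=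
    (dist_triangle_right (ω i) (ω j) (c i)).trans_lt (add_lt_add (hc i) (hij ▸ hc j))
  have h4 : C * ((2 * C)⁻¹ + (2 * C)⁻¹) = 1 := by field_simp; norm_num
  nlinarith

/-! ### Pure states -/

theorem mem_effects_of_extremePoints (Ω : StateSpace V) [FiniteDimensional ℝ V]
    {e : Module.Dual ℝ V} (he : ∀ ω ∈ Ω.states.extremePoints ℝ, e ω ∈ Set.Icc (0 : ℝ) 1) :
    e ∈ Ω.effects := by
  have h : closure (convexHull ℝ (Ω.states.extremePoints ℝ)) ⊆ e ⁻¹' Set.Icc (0 : ℝ) 1 :=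
    closure_minimal (convexHull_min he ((convex_Icc 0 1).linear_preimage e))
      (isClosed_Icc.preimage (LinearMap.continuous_of_finiteDimensional e))
  rw [closure_convexHull_extremePoints Ω.isCompact Ω.convex] at h
  exact h

theorem span_extremePoints (Ω : StateSpace V) [FiniteDimensional ℝ V] :
    Submodule.span ℝ (Ω.states.extremePoints ℝ) = ⊤ := by
  rw [eq_top_iff, ← Ω.span_eq_top, Submodule.span_le]
  have h : closure (convexHull ℝ (Ω.states.extremePoints ℝ)) ⊆
      (Submodule.span ℝ (Ω.states.extremePoints ℝ) : Set V) :=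
    closure_minimal (convexHull_min Submodule.subset_span (Submodule.convex _))
      (Submodule.closed_of_finiteDimensional _)
  rwa [closure_convexHull_extremePoints Ω.isCompact Ω.convex] at h

/-- A normalized vector on which all effects are nonnegative is a state (Hahn–Banach). -/
theorem mem_states_of_forall_effects_nonneg [FiniteDimensional ℝ V] (Ω : StateSpace V) {v : V}
    (hu : Ω.unit v = 1) (h : ∀ e ∈ Ω.effects, 0 ≤ e v) : v ∈ Ω.states := by
  by_contra hv
  obtain ⟨f, s, hfv, hfs⟩ :=
    geometric_hahn_banach_point_closed Ω.convex Ω.isCompact.isClosed hv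
  obtain ⟨C, hC⟩ := Ω.isCompact.exists_bound_of_continuousOn f.continuous.continuousOn
  -- the separating functional, normalized so that the hyperplane is its zero set, and rescaled
  set K : ℝ := |C| + |s| + 1 with hK
  have hK0 : 0 < K := by positivity
  have := h (K⁻¹ • ((f : V →ₗ[ℝ] ℝ) - s • Ω.unit)) fun ω hω => by
    have h1 := (abs_le.1 ((hC ω hω).trans (le_abs_self C))).2
    have h2 := neg_abs_le s
    have h3 := hfs ω hω
    simp only [LinearMap.smul_apply, LinearMap.sub_apply, Ω.unit_apply hω, smul_eq_mul, mul_one,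
      Set.mem_Icc, ContinuousLinearMap.coe_coe]
    constructor
    · exact mul_nonneg (by positivity) (by linarith)
    · rw [inv_mul_le_iff₀ hK0]
      linarith
  simp only [LinearMap.smul_apply, LinearMap.sub_apply, hu, smul_eq_mul, mul_one,
    ContinuousLinearMap.coe_coe] at this
  have := nonneg_of_mul_nonneg_right this (by positivity)
  linarith

/-- A pure state spans an extreme ray of the cone of unnormalized states. -/
theorem eq_smul_of_add_eq_extremePoint [FiniteDimensional ℝ V] (Ω : StateSpace V) {p v w : V}
    (hp : p ∈ Ω.states.extremePoints ℝ) (hv : ∀ e ∈ Ω.effects, 0 ≤ e v)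
    (hw : ∀ e ∈ Ω.effects, 0 ≤ e w) (h : v + w = p) : v = Ω.unit v • p := by
  have hadd : Ω.unit v + Ω.unit w = 1 := by
    rw [← map_add, h, Ω.unit_apply hp.1]
  -- a positive vector of weight zero vanishes
  have hzero : ∀ x, (∀ e ∈ Ω.effects, 0 ≤ e x) → Ω.unit x = 0 → x = 0 := fun x hx h0 =>
    Ω.ext_effects fun e he => by
      have h1 := hx _ (Ω.unit_sub_mem_effects he)
      rw [LinearMap.sub_apply, h0] at h1
      rw [map_zero]
      linarith [hx e he]
  rcases (hv _ Ω.unit_mem_effects).eq_or_lt with h0 | hv0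
  · rw [hzero v hv h0.symm]; simp
  rcases (hw _ Ω.unit_mem_effects).eq_or_lt with h0 | hw0
  · have hw' := hzero w hw h0.symm
    have h1 : Ω.unit v = 1 := by linarith
    rw [h1, one_smul, ← h, hw', add_zero]
  have hnorm : ∀ x, (∀ e ∈ Ω.effects, 0 ≤ e x) → 0 < Ω.unit x → (Ω.unit x)⁻¹ • x ∈ Ω.states :=
    fun x hx h0 => Ω.mem_states_of_forall_effects_nonneg (by simp [h0.ne'])
      fun e he => by simpa using mul_nonneg (inv_nonneg.2 h0.le) (hx e he)
  have key := hp.2 (hnorm v hv hv0) (hnorm w hw hw0)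
    ⟨Ω.unit v, Ω.unit w, hv0, hw0, hadd, by
      rw [smul_smul, smul_smul, mul_inv_cancel₀ hv0.ne', mul_inv_cancel₀ hw0.ne', one_smul,
        one_smul, h]⟩
  rw [← key, smul_smul, mul_inv_cancel₀ hv0.ne', one_smul]

/-! ### Reversible dynamics -/

theorem exists_linearEquiv_of_mem_GL [FiniteDimensional ℝ V] {Ω : StateSpace V} {Λ : V →ₗ[ℝ] V}
    (hΛ : Λ ∈ Ω.GL) : ∃ L : V ≃ₗ[ℝ] V, (L : V →ₗ[ℝ] V) = Λ ∧ L '' Ω.states = Ω.states ∧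
      (L.symm : V →ₗ[ℝ] V) ∈ channels Ω Ω := by
  have hsurj : Function.Surjective Λ := by
    rw [← LinearMap.range_eq_top, eq_top_iff, ← Ω.span_eq_top, Submodule.span_le]
    intro ω hω
    obtain ⟨σ, -, rfl⟩ := hΛ.2.surjOn hω
    exact ⟨σ, rfl⟩
  let L : V ≃ₗ[ℝ] V := LinearEquiv.ofBijective Λ
    ⟨LinearMap.injective_iff_surjective.2 hsurj, hsurj⟩
  have hL : L '' Ω.states = Ω.states := hΛ.2.image_eq
  refine ⟨L, rfl, hL, fun ω hω => ?_⟩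
  rw [← hL] at hω
  obtain ⟨σ, hσ, rfl⟩ := hω
  simpa using hσ

theorem map_mem_extremePoints {Ω : StateSpace V} {L : V ≃ₗ[ℝ] V} (hL : L '' Ω.states = Ω.states)
    {ω : V} (hω : ω ∈ Ω.states.extremePoints ℝ) : L ω ∈ Ω.states.extremePoints ℝ := by
  rw [← hL, ← image_extremePoints]
  exact ⟨ω, hω, rfl⟩

/-- If every pure state is an eigenvector of `T`, pure states with different eigenvalues have
fidelity zero: a polynomial in `T` projects onto one eigenspace along the others, and the unit
effect composed with this projection is an effect that distinguishes them. -/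
theorem fidelity_eq_zero_of_eigenvalue_ne [FiniteDimensional ℝ V] (Ω : StateSpace V)
    (T : V →ₗ[ℝ] V) (l : V → ℝ) (hT : ∀ ω ∈ Ω.states.extremePoints ℝ, T ω = l ω • ω) {a b : V}
    (ha : a ∈ Ω.states.extremePoints ℝ) (hb : b ∈ Ω.states.extremePoints ℝ) (h : l a ≠ l b) :
    Ω.fidelity a b = 0 := by
  classical
  set s : Finset ℝ := (Module.End.finite_hasEigenvalue (f := T)).toFinset with hs
  have hmem : ∀ ω ∈ Ω.states.extremePoints ℝ, l ω ∈ s := fun ω hω => by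
    have hne : ω ≠ 0 := by
      rintro rfl
      simpa using Ω.unit_apply hω.1
    rw [hs, Set.Finite.mem_toFinset]
    exact Module.End.hasEigenvalue_of_hasEigenvector
      ⟨Module.End.mem_eigenspace_iff.2 (hT ω hω), hne⟩
  let P : Polynomial ℝ := Lagrange.basis s id (l a)
  let e : Module.Dual ℝ V := Ω.unit ∘ₗ (Polynomial.aeval T P : V →ₗ[ℝ] V)
  have he : ∀ ω ∈ Ω.states.extremePoints ℝ, e ω = P.eval (l ω) := fun ω hω => by
    have := Module.End.aeval_apply_of_mem_apply_eq_smul (p := P) (hT ω hω)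
    simp only [e, LinearMap.comp_apply]
    rw [this, map_smul, Ω.unit_apply hω.1, smul_eq_mul, mul_one]
  have h1 : P.eval (l a) = 1 := Lagrange.eval_basis_self (v := id)
    Function.injective_id.injOn (hmem a ha)
  have h0 : ∀ ω ∈ Ω.states.extremePoints ℝ, l a ≠ l ω → P.eval (l ω) = 0 := fun ω hω hne =>
    Lagrange.eval_basis_of_ne (v := id) hne (hmem ω hω)
  refine Ω.fidelity_eq_zero_of_effect ha.1 (e := e)
    (Ω.mem_effects_of_extremePoints fun ω hω => ?_) ((he a ha).trans h1)
    ((he b hb).trans (h0 b hb h))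
  rw [he ω hω]
  by_cases hl : l a = l ω
  · rw [← hl, h1]; simp
  · rw [h0 ω hω hl]; simp

end StateSpace

end Single

/-! ### Composite systems -/

section Bipartite

variable {V W : Type*} [NormedAddCommGroup V] [InnerProductSpace ℝ V]
  [NormedAddCommGroup W] [InnerProductSpace ℝ W]

/-- The partial contraction `id ⊗ f : V ⊗ W → V`. -/
def contractRight (f : Module.Dual ℝ W) : V ⊗[ℝ] W →ₗ[ℝ] V :=
  (TensorProduct.rid ℝ V).toLinearMap ∘ₗ f.lTensor V

/-- The partial contraction `e ⊗ id : V ⊗ W → W`. -/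
def contractLeft (e : Module.Dual ℝ V) : V ⊗[ℝ] W →ₗ[ℝ] W :=
  (TensorProduct.lid ℝ W).toLinearMap ∘ₗ e.rTensor W

@[simp] theorem contractRight_tmul (f : Module.Dual ℝ W) (v : V) (w : W) :
    contractRight f (v ⊗ₜ[ℝ] w) = f w • v := by
  simp [contractRight]

@[simp] theorem contractLeft_tmul (e : Module.Dual ℝ V) (v : V) (w : W) :
    contractLeft e (v ⊗ₜ[ℝ] w) = e v • w := by
  simp [contractLeft]

@[simp] theorem prodFunctional_tmul (e : Module.Dual ℝ V) (f : Module.Dual ℝ W) (v : V) (w : W) :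
    prodFunctional e f (v ⊗ₜ[ℝ] w) = e v * f w := by
  simp [prodFunctional]

theorem apply_contractRight (e : Module.Dual ℝ V) (f : Module.Dual ℝ W) (μ : V ⊗[ℝ] W) :
    e (contractRight f μ) = prodFunctional e f μ := by
  have : e ∘ₗ contractRight f = prodFunctional e f := by
    ext v w
    simp [mul_comm]
  exact LinearMap.congr_fun this μ

theorem apply_contractLeft (e : Module.Dual ℝ V) (f : Module.Dual ℝ W) (μ : V ⊗[ℝ] W) :
    f (contractLeft e μ) = prodFunctional e f μ := by
  have : f ∘ₗ contractLeft e = prodFunctional e f := by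
    ext v w
    simp
  exact LinearMap.congr_fun this μ

theorem prodFunctional_sub_left (e e' : Module.Dual ℝ V) (f : Module.Dual ℝ W) :
    prodFunctional (e - e') f = prodFunctional e f - prodFunctional e' f := by
  simp [prodFunctional, TensorProduct.sub_tmul]

theorem prodFunctional_sub_right (e : Module.Dual ℝ V) (f f' : Module.Dual ℝ W) :
    prodFunctional e (f - f') = prodFunctional e f - prodFunctional e f' := by
  simp [prodFunctional, TensorProduct.tmul_sub]

/-- Product functionals separate the points of `V ⊗ W`. -/
theorem ext_prodFunctional [FiniteDimensional ℝ V] [FiniteDimensional ℝ W] {μ ν : V ⊗[ℝ] W}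
    (h : ∀ e f, prodFunctional e f μ = prodFunctional e f ν) : μ = ν := by
  rw [← sub_eq_zero, ← Module.forall_dual_apply_eq_zero_iff ℝ]
  intro g
  obtain ⟨t, rfl⟩ := (TensorProduct.dualDistribEquiv ℝ V W).surjective g
  change TensorProduct.dualDistrib ℝ V W t (μ - ν) = 0
  induction t with
  | zero => simp
  | tmul e f => simpa [sub_eq_zero, prodFunctional] using h e f
  | add x y hx hy => rw [map_add, LinearMap.add_apply, hx, hy, add_zero]

variable {Ω₁ : StateSpace V} {Ω₂ : StateSpace W} {Ω : StateSpace (V ⊗[ℝ] W)}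

theorem IsComposite.tmul_mem (h : IsComposite Ω₁ Ω₂ Ω) {ω : V} {ξ : W} (hω : ω ∈ Ω₁.states)
    (hξ : ξ ∈ Ω₂.states) : ω ⊗ₜ[ℝ] ξ ∈ Ω.states :=
  h.1 (subset_convexHull ℝ _ ⟨ω, hω, ξ, hξ, rfl⟩)

theorem IsComposite.prodFunctional_unit (h : IsComposite Ω₁ Ω₂ Ω) :
    prodFunctional Ω₁.unit Ω₂.unit = Ω.unit :=
  Ω.eq_unit_of_forall fun _ hμ => (h.2 hμ).1

theorem IsComposite.prodFunctional_mem_effects (h : IsComposite Ω₁ Ω₂ Ω) {e : Module.Dual ℝ V}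
    (he : e ∈ Ω₁.effects) {f : Module.Dual ℝ W} (hf : f ∈ Ω₂.effects) :
    prodFunctional e f ∈ Ω.effects := fun μ hμ => by
  obtain ⟨h1, h2⟩ := h.2 hμ
  refine ⟨h2 e he f hf, ?_⟩
  -- `u ⊗ u - e ⊗ f = (u - e) ⊗ u + e ⊗ (u - f)`
  have h3 := h2 _ (Ω₁.unit_sub_mem_effects he) _ Ω₂.unit_mem_effects
  have h4 := h2 e he _ (Ω₂.unit_sub_mem_effects hf)
  rw [prodFunctional_sub_left, LinearMap.sub_apply] at h3
  rw [prodFunctional_sub_right, LinearMap.sub_apply] at h4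
  linarith

theorem IsComposite.isObservable_prod (h : IsComposite Ω₁ Ω₂ Ω) {X Y : Type*} [Fintype X]
    [Fintype Y] {E : X → Module.Dual ℝ V} (hE : Ω₁.IsObservable E) {F : Y → Module.Dual ℝ W}
    (hF : Ω₂.IsObservable F) :
    Ω.IsObservable fun z : X × Y => prodFunctional (E z.1) (F z.2) := by
  refine ⟨fun z => h.prodFunctional_mem_effects (hE.1 _) (hF.1 _), ?_⟩
  rw [← h.prodFunctional_unit, ← hE.2, ← hF.2]
  simp only [prodFunctional]
  rw [TensorProduct.sum_tmul, map_sum, Fintype.sum_prod_type]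
  simp [TensorProduct.tmul_sum]

/-- The fidelity of product vectors is submultiplicative, as product observables are available. -/
theorem IsComposite.fidelity_tmul_le (h : IsComposite Ω₁ Ω₂ Ω) {a b : V} (ha : a ∈ Ω₁.states)
    (hb : b ∈ Ω₁.states) (ξ η : W) :
    Ω.fidelity (a ⊗ₜ[ℝ] ξ) (b ⊗ₜ[ℝ] η) ≤ Ω₁.fidelity a b * Ω₂.fidelity ξ η := by
  refine le_mul_of_forall_lt₀ fun r hr s hs => ?_
  obtain ⟨n, E, hE, hEr⟩ := Ω₁.exists_observable_lt hr
  obtain ⟨m, F, hF, hFs⟩ := Ω₂.exists_observable_lt hs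
  refine (Ω.fidelity_le (h.isObservable_prod hE hF) _ _).trans ?_
  calc ∑ z : Fin n × Fin m, Real.sqrt (prodFunctional (E z.1) (F z.2) (a ⊗ₜ[ℝ] ξ)) *
        Real.sqrt (prodFunctional (E z.1) (F z.2) (b ⊗ₜ[ℝ] η))
      = (∑ x, Real.sqrt (E x a) * Real.sqrt (E x b)) *
        ∑ y, Real.sqrt (F y ξ) * Real.sqrt (F y η) := by
        rw [Finset.sum_mul_sum, Fintype.sum_prod_type]
        refine Finset.sum_congr rfl fun x _ => Finset.sum_congr rfl fun y _ => ?_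
        rw [prodFunctional_tmul, prodFunctional_tmul, Real.sqrt_mul (hE.1 x a ha).1,
          Real.sqrt_mul (hE.1 x b hb).1]
        ring
    _ ≤ r * s := mul_le_mul hEr.le hFs.le (by positivity)
        ((Ω₁.fidelity_nonneg a b).trans hr.le)

theorem IsComposite.fidelity_le_tmul (h : IsComposite Ω₁ Ω₂ Ω) {a : V} (ha : a ∈ Ω₁.states)
    (ξ η : W) : Ω₂.fidelity ξ η ≤ Ω.fidelity (a ⊗ₜ[ℝ] ξ) (a ⊗ₜ[ℝ] η) :=
  StateSpace.fidelity_le_fidelity_map (Φ := TensorProduct.mk ℝ V W a)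
    (fun _ hσ => h.tmul_mem ha hσ) ξ η

/-- A bipartite state whose first marginal is pure is a product. -/
theorem eq_tmul_of_marginal_mem_extremePoints [FiniteDimensional ℝ V] [FiniteDimensional ℝ W]
    {μ : V ⊗[ℝ] W} (hμ : μ ∈ maxTensor Ω₁ Ω₂) {p : V} (hp : p ∈ Ω₁.states.extremePoints ℝ)
    (h : contractRight Ω₂.unit μ = p) : μ = p ⊗ₜ[ℝ] contractLeft Ω₁.unit μ := by
  have key : ∀ f ∈ Ω₂.effects, contractRight f μ = f (contractLeft Ω₁.unit μ) • p := by
    intro f hf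
    rw [apply_contractLeft, ← apply_contractRight]
    refine Ω₁.eq_smul_of_add_eq_extremePoint hp (w := contractRight (Ω₂.unit - f) μ)
      (fun e he => ?_) (fun e he => ?_) (Ω₁.ext_effects fun e _ => ?_)
    · rw [apply_contractRight]; exact hμ.2 e he f hf
    · rw [apply_contractRight]; exact hμ.2 e he _ (Ω₂.unit_sub_mem_effects hf)
    · rw [map_add, ← h, apply_contractRight, apply_contractRight, apply_contractRight,
        prodFunctional_sub_right, LinearMap.sub_apply]
      ring
  refine ext_prodFunctional fun e f => ?_
  rw [prodFunctional_tmul, ← apply_contractLeft]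
  obtain ⟨f₀, hf₀, c, d, rfl⟩ := Ω₂.exists_eq_smul_effect_add_smul_unit f
  have h1 : ∀ f ∈ Ω₂.effects,
      f (contractLeft e μ) = e p * f (contractLeft Ω₁.unit μ) := fun f hf => by
    rw [apply_contractLeft, ← apply_contractRight, key f hf, map_smul, smul_eq_mul, mul_comm]
  simp only [LinearMap.add_apply, LinearMap.smul_apply, smul_eq_mul, h1 f₀ hf₀,
    h1 _ Ω₂.unit_mem_effects]
  ring

/-! ### Programming reversible dynamics -/

variable [FiniteDimensional ℝ V] [FiniteDimensional ℝ W]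

/-- On a pure input, implementing a reversible dynamics leaves system and apparatus uncorrelated. -/
theorem Implements.apply_tmul (h : IsComposite Ω₁ Ω₂ Ω) {Λ : V ⊗[ℝ] W →ₗ[ℝ] V ⊗[ℝ] W}
    (hΛ : Λ ∈ channels Ω Ω) {ξ : W} (hξ : ξ ∈ Ω₂.states) {A : V ≃ₗ[ℝ] V}
    (hA : A '' Ω₁.states = Ω₁.states) (hi : Implements Ω₁ Ω₂ Λ ξ A) {a : V}
    (ha : a ∈ Ω₁.states.extremePoints ℝ) :
    Λ (a ⊗ₜ[ℝ] ξ) = A a ⊗ₜ[ℝ] contractLeft Ω₁.unit (Λ (a ⊗ₜ[ℝ] ξ)) := by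
  refine eq_tmul_of_marginal_mem_extremePoints (h.2 (hΛ (h.tmul_mem ha.1 hξ)))
    (StateSpace.map_mem_extremePoints hA ha) (Ω₁.ext_effects fun e he => ?_)
  rw [apply_contractRight]
  exact hi a ha.1 e he

/-- The residual state of the apparatus depends on the pure input only through perfectly
distinguishable alternatives: testing it with a functional `f` makes every pure state an
eigenvector of `α⁻¹ ∘ (id ⊗ f) ∘ Λ ∘ (· ⊗ ξ)`. -/
theorem Implements.residual_eq_or_fidelity_eq_zero (h : IsComposite Ω₁ Ω₂ Ω)
    {Λ : V ⊗[ℝ] W →ₗ[ℝ] V ⊗[ℝ] W} (hΛ : Λ ∈ channels Ω Ω) {ξ : W} (hξ : ξ ∈ Ω₂.states)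
    {A : V ≃ₗ[ℝ] V} (hA : A '' Ω₁.states = Ω₁.states) (hi : Implements Ω₁ Ω₂ Λ ξ A) {a b : V}
    (ha : a ∈ Ω₁.states.extremePoints ℝ) (hb : b ∈ Ω₁.states.extremePoints ℝ) :
    contractLeft Ω₁.unit (Λ (a ⊗ₜ[ℝ] ξ)) = contractLeft Ω₁.unit (Λ (b ⊗ₜ[ℝ] ξ)) ∨
      Ω₁.fidelity a b = 0 := by
  by_contra! H
  obtain ⟨hne, h0⟩ := H
  refine hne (Ω₂.ext_effects fun f _ => ?_)
  by_contra hf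
  refine h0 (Ω₁.fidelity_eq_zero_of_eigenvalue_ne
    ((A.symm : V →ₗ[ℝ] V) ∘ₗ contractRight f ∘ₗ Λ ∘ₗ (TensorProduct.mk ℝ V W).flip ξ)
    (fun ω => f (contractLeft Ω₁.unit (Λ (ω ⊗ₜ[ℝ] ξ)))) (fun ω hω => ?_) ha hb hf)
  have := congrArg (contractRight f) (hi.apply_tmul h hΛ hξ hA hω)
  rw [contractRight_tmul] at this
  simp [this]

/-- Programs of distinct reversible dynamics have fidelity zero. -/
theorem Implements.fidelity_eq_zero (h : IsComposite Ω₁ Ω₂ Ω)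
    {Λ : V ⊗[ℝ] W →ₗ[ℝ] V ⊗[ℝ] W} (hΛ : Λ ∈ Ω.GL) {ξ η : W} (hξ : ξ ∈ Ω₂.states)
    (hη : η ∈ Ω₂.states) {α β : V →ₗ[ℝ] V} (hα : α ∈ Ω₁.GL) (hβ : β ∈ Ω₁.GL)
    (hiα : Implements Ω₁ Ω₂ Λ ξ α) (hiβ : Implements Ω₁ Ω₂ Λ η β) (hne : α ≠ β) :
    Ω₂.fidelity ξ η = 0 := by
  obtain ⟨A, rfl, hA, -⟩ := StateSpace.exists_linearEquiv_of_mem_GL hα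
  obtain ⟨B, rfl, hB, hBsymm⟩ := StateSpace.exists_linearEquiv_of_mem_GL hβ
  obtain ⟨L, hL, -, hLsymm⟩ := StateSpace.exists_linearEquiv_of_mem_GL hΛ
  obtain ⟨a, ha, hAB⟩ : ∃ a ∈ Ω₁.states.extremePoints ℝ, A a ≠ B a := by
    by_contra! H
    exact hne (LinearMap.ext_on Ω₁.span_extremePoints H)
  -- `b` is the pure input on which `η` produces the output `A a` that `ξ` produces on `a`
  obtain ⟨b, hb, hBb⟩ : ∃ b ∈ Ω₁.states.extremePoints ℝ, B b = A a := by
    have := StateSpace.map_mem_extremePoints hA ha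
    rw [← hB, ← image_extremePoints] at this
    exact this
  have hba : a ≠ b := fun hab => hAB (by rw [← hBb, hab])
  set g := Ω₁.fidelity a b with hg
  have hg1 : g < 1 := Ω₁.fidelity_lt_one ha.1 hb.1 hba
  have hg0 : 0 ≤ g := Ω₁.fidelity_nonneg a b
  have hout : Ω₁.fidelity (A a) (B a) ≤ g := by
    refine (StateSpace.fidelity_le_fidelity_map hBsymm _ _).trans_eq ?_
    rw [← hBb]
    simp only [LinearEquiv.coe_coe, LinearEquiv.symm_apply_apply]
    simp only [hg, StateSpace.fidelity, mul_comm]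
  let ξ' : V → W := fun ω => contractLeft Ω₁.unit (Λ (ω ⊗ₜ[ℝ] ξ))
  let η' : V → W := fun ω => contractLeft Ω₁.unit (Λ (ω ⊗ₜ[ℝ] η))
  have hξ' : Λ (a ⊗ₜ[ℝ] ξ) = A a ⊗ₜ[ℝ] ξ' a := hiα.apply_tmul h hΛ.1 hξ hA ha
  have hη'a : Λ (a ⊗ₜ[ℝ] η) = B a ⊗ₜ[ℝ] η' a := hiβ.apply_tmul h hΛ.1 hη hB ha
  have hη'b : Λ (b ⊗ₜ[ℝ] η) = A a ⊗ₜ[ℝ] η' b := by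
    rw [← hBb]; exact hiβ.apply_tmul h hΛ.1 hη hB hb
  have hAa : A a ∈ Ω₁.states := hα.1 ha.1
  have hBa : B a ∈ Ω₁.states := hβ.1 ha.1
  have hm := Ω₂.fidelity_nonneg (ξ' a) (η' a)
  have hf := Ω₂.fidelity_nonneg ξ η
  have step1 : Ω₂.fidelity ξ η ≤ g * Ω₂.fidelity (ξ' a) (η' a) :=
    calc Ω₂.fidelity ξ η ≤ Ω.fidelity (a ⊗ₜ[ℝ] ξ) (a ⊗ₜ[ℝ] η) := h.fidelity_le_tmul ha.1 ξ η
      _ ≤ Ω.fidelity (Λ (a ⊗ₜ[ℝ] ξ)) (Λ (a ⊗ₜ[ℝ] η)) :=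
        StateSpace.fidelity_le_fidelity_map hΛ.1 _ _
      _ ≤ Ω₁.fidelity (A a) (B a) * Ω₂.fidelity (ξ' a) (η' a) := by
        rw [hξ', hη'a]; exact h.fidelity_tmul_le hAa hBa _ _
      _ ≤ g * Ω₂.fidelity (ξ' a) (η' a) := mul_le_mul_of_nonneg_right hout hm
  have step2 : Ω₂.fidelity (ξ' a) (η' b) ≤ g * Ω₂.fidelity ξ η :=
    calc Ω₂.fidelity (ξ' a) (η' b)
        ≤ Ω.fidelity (A a ⊗ₜ[ℝ] ξ' a) (A a ⊗ₜ[ℝ] η' b) := h.fidelity_le_tmul hAa _ _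
      _ = Ω.fidelity (L (a ⊗ₜ[ℝ] ξ)) (L (b ⊗ₜ[ℝ] η)) := by
        rw [← hξ', ← hη'b, ← hL]; rfl
      _ ≤ Ω.fidelity (a ⊗ₜ[ℝ] ξ) (b ⊗ₜ[ℝ] η) := by
        simpa using StateSpace.fidelity_le_fidelity_map hLsymm (L (a ⊗ₜ[ℝ] ξ)) (L (b ⊗ₜ[ℝ] η))
      _ ≤ g * Ω₂.fidelity ξ η := h.fidelity_tmul_le ha.1 hb.1 ξ η
  rcases hiβ.residual_eq_or_fidelity_eq_zero h hΛ.1 hη hB ha hb with heq | h0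
  · have heq' : η' b = η' a := heq.symm
    rw [heq'] at step2
    -- `f ≤ g m ≤ g² f` with `g < 1`
    have h3 : Ω₂.fidelity ξ η ≤ g * (g * Ω₂.fidelity ξ η) :=
      step1.trans (mul_le_mul_of_nonneg_left step2 hg0)
    have h4 : g * (g * Ω₂.fidelity ξ η) ≤ g * Ω₂.fidelity ξ η :=
      mul_le_mul_of_nonneg_left (mul_le_of_le_one_left hf hg1.le) hg0
    nlinarith
  · have h1 : g = 0 := h0
    rw [h1, zero_mul] at step1
    exact le_antisymm step1 hf

end Bipartite

end GPT

end

theorem mainTheorem1 {V W : Type*}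
    [NormedAddCommGroup V] [InnerProductSpace ℝ V] [FiniteDimensional ℝ V]
    [NormedAddCommGroup W] [InnerProductSpace ℝ W] [FiniteDimensional ℝ W]
    (Ωsys : GPT.StateSpace V) (Ωapp : GPT.StateSpace W) (Ωtot : GPT.StateSpace (V ⊗[ℝ] W))
    (htot : GPT.IsComposite Ωsys Ωapp Ωtot)
    (Λ : V ⊗[ℝ] W →ₗ[ℝ] V ⊗[ℝ] W) (hΛ : Λ ∈ Ωtot.GL) :
    -- programs of distinct reversible dynamics are perfectly distinguishable
    (∀ ξ ∈ Ωapp.states, ∀ η ∈ Ωapp.states, ∀ α ∈ Ωsys.GL, ∀ β ∈ Ωsys.GL,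
      GPT.Implements Ωsys Ωapp Λ ξ α → GPT.Implements Ωsys Ωapp Λ η β → α ≠ β →
        Ωapp.PerfectlyDistinguishable ![ξ, η] ∧ Ωapp.fidelity ξ η = 0) ∧
    -- any family of programs of pairwise distinct reversible dynamics is pairwise distinguishable
    (∀ (ι : Type*) (ξ : ι → W) (α : ι → V →ₗ[ℝ] V),
      (∀ i, ξ i ∈ Ωapp.states) → (∀ i, α i ∈ Ωsys.GL) →
      (∀ i, GPT.Implements Ωsys Ωapp Λ (ξ i) (α i)) → Function.Injective α →
        Ωapp.PairwiseDistinguishable ξ) ∧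
    -- only finitely many reversible dynamics can be programmed
    {α | α ∈ Ωsys.GL ∧ ∃ ξ ∈ Ωapp.states, GPT.Implements Ωsys Ωapp Λ ξ α}.Finite := by
  have hpair : ∀ ξ ∈ Ωapp.states, ∀ η ∈ Ωapp.states, ∀ α ∈ Ωsys.GL, ∀ β ∈ Ωsys.GL,
      GPT.Implements Ωsys Ωapp Λ ξ α → GPT.Implements Ωsys Ωapp Λ η β → α ≠ β →
        Ωapp.PerfectlyDistinguishable ![ξ, η] ∧ Ωapp.fidelity ξ η = 0 := by
    intro ξ hξ η hη α hα β hβ hiα hiβ hne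
    have h0 := hiα.fidelity_eq_zero htot hΛ hξ hη hα hβ hiβ hne
    exact ⟨Ωapp.perfectlyDistinguishable_of_fidelity_eq_zero hξ hη h0, h0⟩
  refine ⟨hpair, fun ι ξ α hξ hα hi hinj i j hij => (hpair _ (hξ i) _ (hξ j) _ (hα i) _ (hα j)
    (hi i) (hi j) (hinj.ne hij)).1, ?_⟩
  -- choose a program for each implementable dynamics
  choose ξ hξ hi using fun α : {α | α ∈ Ωsys.GL ∧ ∃ ξ ∈ Ωapp.states,
    GPT.Implements Ωsys Ωapp Λ ξ α} => α.2.2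
  have hdist : Ωapp.PairwiseDistinguishable ξ := fun α β hne => (hpair _ (hξ α) _ (hξ β) _ α.2.1 _
    β.2.1 (hi α) (hi β) (Subtype.coe_injective.ne hne)).1
  exact Set.finite_coe_iff.1 (hdist.finite hξ)
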